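/- Let $d$ and $L$ be positive integers, and let $B$ be a real invertible $d\times d$ matrix such that $(B^T)^{-1}\mathbf n\notin(-2,2)^d$ for all $\mathbf n\in\mathbb Z^d\setminus\{\mathbf 0\}$. For $\mathbf x=(x_1,\dots,x_d)\in\mathbb R^d$ define $$g(\mathbf x)=\Big(\prod_{j=1}^d \sin^{L}(\pi x_j/2)\Big)\,\chi_{[0,2]^d}(\mathbf x)$$ and $$h(\mathbf x)=|\det B|\,\Big(\prod_{j=1}^d \Big[\sin^{L}(\pi x_j/2)\sum_{k=0}^{L-1}\binom{2L-1}{k}\sin^{2(L-1-k)}(\pi x_j/2)\cos^{2k}(\pi x_j/2)\Big]\Big)\,\chi_{[0,2]^d}(\mathbf x).$$ For $u\in L^2(\mathbb R^d)$ and $\mathbf m,\mathbf n\in\mathbb Z^d$ write $(E_{B\mathbf m}T_{\mathbf n}u)(\mathbf x)=e^{2\pi i B\mathbf m\cdot\mathbf x}\,u(\mathbf x-\mathbf n)$. Then $g,h\in C^{L-1}(\mathbb R^d)$, both lie in $L^2(\mathbb R^d)$, and $\{E_{B\mathbf m}T_{\mathbf n}g\}_{\mathbf m,\mathbf n\in\mathbb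 Z^d}$ and $\{E_{B\mathbf m}T_{\mathbf n}h\}_{\mathbf m,\mathbf n\in\mathbb Z^d}$ form a pair of dual frames for $L^2(\mathbb R^d)$: both are frames, that is, for each $u\in\{g,h\}$ there are constants $0<A\le C<\infty$ such that $$A\|f\|^2\le\sum_{\mathbf m,\mathbf n\in\mathbb Z^d}|\langle f,E_{B\mathbf m}T_{\mathbf n}u\rangle|^2\le C\|f\|^2\quad\text{for all } f\in L^2(\mathbb R^d),$$ and every $f\in L^2(\mathbb R^d)$ satisfies, with unconditional convergence in $L^2(\mathbb R^d)$, $$f=\sum_{\mathbf m,\mathbf n\in\mathbb Z^d}\langle f,E_{B\mathbf m}T_{\mathbf n}g\rangle\,E_{B\mathbf m}T_{\mathbf n}h=\sum_{\mathbf m,\mathbf n\in\mathbb Z^d}\langle f,E_{B\mathbf m}T_{\mathbf n}h\rangle\,E_{B\mathbf m}T_{\mathbf n}g .$$ -/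

import Mathlib

open MeasureTheory
open scoped ENNReal

noncomputable section

namespace GaborDual

/-- The sequence `f` is a frame for the Hilbert space `H`: there are `0 < A` and `C` such that
`A ‖x‖² ≤ ∑ᵢ |⟨x, f i⟩|² ≤ C ‖x‖²` for all `x`, the series being convergent. -/
def IsFrame {ι H : Type*} [NormedAddCommGroup H] [InnerProductSpace ℂ H] (f : ι → H) : Prop :=
  ∃ A C : ℝ, 0 < A ∧ ∀ x : H,
    Summable (fun i => ‖inner ℂ (f i) x‖ ^ 2) ∧
    A * ‖x‖ ^ 2 ≤ ∑' i, ‖inner ℂ (f i) x‖ ^ 2 ∧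
    ∑' i, ‖inner ℂ (f i) x‖ ^ 2 ≤ C * ‖x‖ ^ 2

/-- `f` and `g` form a pair of dual frames: both are frames, and
`x = ∑ᵢ ⟨x, f i⟩ g i = ∑ᵢ ⟨x, g i⟩ f i` unconditionally, for all `x`.
(Mathlib's inner product is linear in its second argument, so `⟨x, f i⟩` is `inner ℂ (f i) x`.) -/
def IsDualFramePair {ι H : Type*} [NormedAddCommGroup H] [InnerProductSpace ℂ H]
    (f g : ι → H) : Prop :=
  IsFrame f ∧ IsFrame g ∧
    ∀ x : H, HasSum (fun i => inner ℂ (f i) x • g i) x ∧ HasSum (fun i => inner ℂ (g i) x • f i) x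

/-- Translation, `(T_y f)(x) = f (x - y)`.  Here `ℝ^d` is `Fin d → ℝ` with Lebesgue measure; only
its linear structure, topology and measure are used, never its norm. -/
def translate {d : ℕ} (y : Fin d → ℝ) (f : (Fin d → ℝ) → ℂ) : (Fin d → ℝ) → ℂ :=
  fun x => f (x - y)

/-- Modulation, `(E_y f)(x) = exp (2 π i y · x) f x`. -/
def modulate {d : ℕ} (y : Fin d → ℝ) (f : (Fin d → ℝ) → ℂ) : (Fin d → ℝ) → ℂ :=
  fun x => Complex.exp (2 * (Real.pi : ℂ) * Complex.I * ((y ⬝ᵥ x : ℝ) : ℂ)) * f x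

theorem memLp_translate {d : ℕ} (y : Fin d → ℝ) {f : (Fin d → ℝ) → ℂ}
    (hf : MemLp f 2 volume) : MemLp (translate y f) 2 volume :=
  hf.comp_measurePreserving (measurePreserving_sub_right volume y)

theorem memLp_modulate {d : ℕ} (y : Fin d → ℝ) {f : (Fin d → ℝ) → ℂ}
    (hf : MemLp f 2 volume) : MemLp (modulate y f) 2 volume := by
  have hc : Continuous fun x : Fin d → ℝ =>
      Complex.exp (2 * (Real.pi : ℂ) * Complex.I * ((y ⬝ᵥ x : ℝ) : ℂ)) := by
    unfold dotProduct
    fun_prop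
  refine hf.of_le (hc.aestronglyMeasurable.mul hf.1) (Filter.Eventually.of_forall fun x => ?_)
  have h1 : 2 * (Real.pi : ℂ) * Complex.I * ((y ⬝ᵥ x : ℝ) : ℂ)
      = ((2 * Real.pi * (y ⬝ᵥ x) : ℝ) : ℂ) * Complex.I := by
    push_cast
    ring
  simp only [modulate, norm_mul, h1, Complex.norm_exp_ofReal_mul_I, one_mul, le_refl]

/-- The integer vector `n` as a vector of `ℝ^d`. -/
def intVec {d : ℕ} (n : Fin d → ℤ) : Fin d → ℝ := fun j => (n j : ℝ)

/-- The Gabor system `{E_{Bm} T_n g}`, indexed by `(m, n) ∈ ℤ^d × ℤ^d`, in `L²(ℝ^d)`. -/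
def gaborSystem {d : ℕ} (B : Matrix (Fin d) (Fin d) ℝ) (g : (Fin d → ℝ) → ℂ)
    (hg : MemLp g 2 volume) (p : (Fin d → ℤ) × (Fin d → ℤ)) :
    Lp ℂ 2 (volume : Measure (Fin d → ℝ)) :=
  (memLp_modulate (B.mulVec (intVec p.1)) (memLp_translate (intVec p.2) hg)).toLp
    (modulate (B.mulVec (intVec p.1)) (translate (intVec p.2) g))

/-- The lattice condition: `(Bᵀ)⁻¹ n ∉ (-N, N)^d` for all `n ∈ ℤ^d \ {0}`. -/
def LatticeCondition {d : ℕ} (B : Matrix (Fin d) (Fin d) ℝ) (N : ℕ) : Prop :=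
  ∀ n : Fin d → ℤ, n ≠ 0 →
    (B.transpose)⁻¹.mulVec (intVec n) ∉ Set.univ.pi fun _ : Fin d => Set.Ioo (-(N : ℝ)) (N : ℝ)

/-- The characteristic function of the cube `[0,2]^d`. -/
def cubeChar {d : ℕ} : (Fin d → ℝ) → ℝ :=
  (Set.univ.pi fun _ : Fin d => Set.Icc (0 : ℝ) 2).indicator 1

/-- The window `g(x) = ∏ⱼ sin^L(π xⱼ / 2) χ_{[0,2]^d}(x)`. -/
def windowG (d L : ℕ) (x : Fin d → ℝ) : ℂ :=
  (((∏ j, Real.sin (Real.pi * x j / 2) ^ L) * cubeChar x : ℝ) : ℂ)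

/-- The window
`h(x) = |det B| ∏ⱼ (sin^L(π xⱼ / 2) ∑_{k=0}^{L-1} binom(2L-1, k) sin^{2(L-1-k)}(π xⱼ / 2)
cos^{2k}(π xⱼ / 2)) χ_{[0,2]^d}(x)`. -/
def windowH {d : ℕ} (B : Matrix (Fin d) (Fin d) ℝ) (L : ℕ) (x : Fin d → ℝ) : ℂ :=
  ((|B.det| * (∏ j, Real.sin (Real.pi * x j / 2) ^ L *
      ∑ k ∈ Finset.range L, ((2 * L - 1).choose k : ℝ) *
        Real.sin (Real.pi * x j / 2) ^ (2 * (L - 1 - k)) *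
        Real.cos (Real.pi * x j / 2) ^ (2 * k)) * cubeChar x : ℝ) : ℂ)

end GaborDual

end

noncomputable section

namespace GaborDual

open UnitAddTorus ComplexConjugate

/-- `ℝ / ℤ` carries its Haar probability measure. -/
local instance : MeasureSpace UnitAddCircle := ⟨AddCircle.haarAddCircle⟩

local instance : IsProbabilityMeasure (volume : Measure UnitAddCircle) :=
  inferInstanceAs (IsProbabilityMeasure AddCircle.haarAddCircle)

/-- The projection of `ℝ^d` onto the torus `(ℝ / ℤ)^d`. -/
def torusMk {d : ℕ} (x : Fin d → ℝ) : UnitAddTorus (Fin d) := fun i => (x i : UnitAddCircle)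

theorem continuous_torusMk {d : ℕ} : Continuous (torusMk (d := d)) := by
  unfold torusMk
  exact continuous_pi fun i => (AddCircle.continuous_mk' (1 : ℝ)).comp (continuous_apply i)

theorem torusMk_eq_iff {d : ℕ} {x y : Fin d → ℝ} :
    torusMk x = torusMk y ↔ ∃ n : Fin d → ℤ, x - y = intVec n := by
  constructor
  · intro h
    have h1 : ∀ i, ∃ n : ℤ, x i - y i = n := fun i => by
      have h2 : ((x i : ℝ) : UnitAddCircle) = (y i : ℝ) := congrFun h i
      rw [← sub_eq_zero, ← AddCircle.coe_sub, AddCircle.coe_eq_zero_iff] at h2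
      obtain ⟨n, hn⟩ := h2
      exact ⟨n, by simpa using hn.symm⟩
    choose n hn using h1
    exact ⟨n, funext hn⟩
  · rintro ⟨n, hn⟩
    funext i
    have h2 : x i - y i = n i := congrFun hn i
    change ((x i : ℝ) : UnitAddCircle) = (y i : ℝ)
    rw [← sub_eq_zero, ← AddCircle.coe_sub, AddCircle.coe_eq_zero_iff]
    exact ⟨n i, by simpa using h2.symm⟩

theorem torusMk_add_intVec {d : ℕ} (x : Fin d → ℝ) (n : Fin d → ℤ) :
    torusMk (x + intVec n) = torusMk x :=
  torusMk_eq_iff.2 ⟨n, by simp⟩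

theorem intVec_injective {d : ℕ} : Function.Injective (intVec (d := d)) := fun m n h => by
  funext i
  have h1 : (m i : ℝ) = n i := congrFun h i
  exact_mod_cast h1

/-- The half-open unit cube `(0,1]^d`. -/
def unitCube (d : ℕ) : Set (Fin d → ℝ) := {x | ∀ i, x i ∈ Set.Ioc (0 : ℝ) 1}

theorem measurableSet_unitCube {d : ℕ} : MeasurableSet (unitCube d) :=
  MeasurableSet.univ_pi' fun _ => measurableSet_Ioc

theorem eq_of_sub_eq_intVec_of_mem_unitCube {d : ℕ} {x y : Fin d → ℝ} (hx : x ∈ unitCube d)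
    (hy : y ∈ unitCube d) {n : Fin d → ℤ} (h : x - y = intVec n) : n = 0 := by
  funext i
  have h1 : x i - y i = n i := congrFun h i
  have h2 : (-1 : ℝ) < n i := by rw [← h1]; linarith [(hx i).1, (hy i).2]
  have h3 : (n i : ℝ) < 1 := by rw [← h1]; linarith [(hx i).2, (hy i).1]
  have h4 : -1 < n i := by exact_mod_cast h2
  have h5 : n i < 1 := by exact_mod_cast h3
  change n i = 0
  omega

theorem exists_sub_intVec_mem_unitCube {d : ℕ} (x : Fin d → ℝ) :
    ∃ n : Fin d → ℤ, x - intVec n ∈ unitCube d := by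
  refine ⟨fun i => ⌈x i⌉ - 1, fun i => ?_⟩
  have h1 := Int.ceil_lt_add_one (x i)
  have h2 := Int.le_ceil (x i)
  simp only [intVec, Pi.sub_apply, Set.mem_Ioc]
  push_cast
  constructor <;> linarith

theorem volume_torus_eq {d : ℕ} {A : Set (UnitAddTorus (Fin d))} (hA : MeasurableSet A) :
    volume A = volume (unitCube d ∩ torusMk ⁻¹' A) := by
  have h := UnitAddTorus.lintegral_preimage (A.indicator (fun _ => (1 : ℝ≥0∞))) (0 : Fin d → ℝ)
  have h1 : (∫⁻ x, A.indicator (fun _ => (1 : ℝ≥0∞)) x) = volume A := by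
    rw [lintegral_indicator hA]; simp
  have h2 : {x : Fin d → ℝ | ∀ i, x i ∈ Set.Ioc ((0 : Fin d → ℝ) i) ((0 : Fin d → ℝ) i + 1)}
      = unitCube d := by
    ext x; simp [unitCube]
  rw [← h1, h, h2]
  have h3 : (fun x : Fin d → ℝ => A.indicator (fun _ => (1 : ℝ≥0∞)) (fun i => (x i : UnitAddCircle)))
      = (torusMk ⁻¹' A).indicator (fun _ => (1 : ℝ≥0∞)) := by
    ext x; rfl
  have hm : MeasurableSet (torusMk ⁻¹' A) := continuous_torusMk.measurable hA
  rw [h3, lintegral_indicator hm]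
  simp [Measure.restrict_apply, Set.inter_comm, hm]

/-- The projection to the torus preserves the measure of sets on which it is injective. -/
theorem volume_image_torusMk {d : ℕ} {E : Set (Fin d → ℝ)} (hE : MeasurableSet E)
    (hinj : Set.InjOn torusMk E) : volume (torusMk '' E) = volume E := by
  have hA : MeasurableSet (torusMk '' E) :=
    hE.image_of_continuousOn_injOn continuous_torusMk.continuousOn hinj
  have hD : MeasurableSet (unitCube d) := measurableSet_unitCube
  have htr (n : Fin d → ℤ) : Measurable fun x : Fin d → ℝ => x + intVec n :=
    measurable_add_const _
  rw [volume_torus_eq hA]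
  have h1 : unitCube d ∩ torusMk ⁻¹' (torusMk '' E) =
      ⋃ n : Fin d → ℤ, (unitCube d ∩ (fun x => x + intVec n) ⁻¹' E) := by
    ext x
    simp only [Set.mem_inter_iff, Set.mem_preimage, Set.mem_iUnion, Set.mem_image]
    constructor
    · rintro ⟨hx, y, hy, hxy⟩
      obtain ⟨n, hn⟩ := torusMk_eq_iff.1 hxy
      exact ⟨n, hx, by rwa [← hn, add_sub_cancel]⟩
    · rintro ⟨n, hx, hy⟩
      exact ⟨hx, _, hy, torusMk_add_intVec x n⟩
  have h2 : E = ⋃ n : Fin d → ℤ, (E ∩ (fun x => x + -intVec n) ⁻¹' unitCube d) := by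
    ext x
    simp only [Set.mem_inter_iff, Set.mem_preimage, Set.mem_iUnion, ← sub_eq_add_neg]
    constructor
    · intro hx
      obtain ⟨n, hn⟩ := exists_sub_intVec_mem_unitCube x
      exact ⟨n, hx, hn⟩
    · rintro ⟨n, hx, -⟩
      exact hx
  rw [h1]
  conv_rhs => rw [h2]
  rw [measure_iUnion, measure_iUnion]
  · refine tsum_congr fun n => ?_
    rw [← measure_preimage_add_right volume (intVec n)
      (E ∩ (fun x => x + -intVec n) ⁻¹' unitCube d)]
    congr 1
    ext x
    simp [and_comm]
  · intro m n hmn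
    refine Set.disjoint_left.2 fun x hx hy => hmn ?_
    have h3 : (x + -intVec n) - (x + -intVec m) = intVec (m - n) := by
      ext i
      simp only [intVec, Pi.add_apply, Pi.sub_apply, Pi.neg_apply, Int.cast_sub]
      ring
    exact sub_eq_zero.1 (eq_of_sub_eq_intVec_of_mem_unitCube hy.2 hx.2 h3)
  · exact fun n => hE.inter ((measurable_add_const _) hD)
  · intro m n hmn
    refine Set.disjoint_left.2 fun x hx hy => hmn (intVec_injective ?_)
    have h3 := hinj hx.2 hy.2 (by simp only [torusMk_add_intVec])
    exact add_left_cancel h3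
  · exact fun n => hD.inter (htr n hE)

/-- **Parseval's identity** on the torus, for functions instead of classes. -/
theorem hasSum_mFourierCoeff_of_memLp {d : ℕ} {Φ Ψ : UnitAddTorus (Fin d) → ℂ}
    (hΦ : MemLp Φ 2 volume) (hΨ : MemLp Ψ 2 volume) :
    HasSum (fun m => conj (mFourierCoeff Φ m) * mFourierCoeff Ψ m)
      (∫ t, conj (Φ t) * Ψ t) := by
  have h := UnitAddTorus.hasSum_prod_mFourierCoeff (hΦ.toLp Φ) (hΨ.toLp Ψ)
  have hc : ∀ {Θ : UnitAddTorus (Fin d) → ℂ} (hΘ : MemLp Θ 2 volume) (m : Fin d → ℤ),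
      mFourierCoeff (hΘ.toLp Θ) m = mFourierCoeff Θ m := fun hΘ m => by
    refine integral_congr_ae ?_
    filter_upwards [hΘ.coeFn_toLp] with t ht
    rw [ht]
  simp only [hc] at h
  convert h using 1
  refine integral_congr_ae ?_
  filter_upwards [hΦ.coeFn_toLp, hΨ.coeFn_toLp] with t h1 h2
  rw [h1, h2]

/-- Parseval's identity for a set that is mapped injectively into the torus, scaling the measure by
`c⁻¹`. -/
theorem hasSum_setIntegral_mFourier {d : ℕ} {E : Set (Fin d → ℝ)} (hE : MeasurableSet E)
    {q : (Fin d → ℝ) → UnitAddTorus (Fin d)} (hq : Continuous q) (hinj : Set.InjOn q E) {c : ℝ}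
    (hc : 0 < c)
    (hvol : ∀ A ⊆ E, MeasurableSet A → volume (q '' A) = ENNReal.ofReal c * volume A)
    {F G : (Fin d → ℝ) → ℂ} (hFm : Measurable F) (hGm : Measurable G)
    (hF : MemLp F 2 volume) (hG : MemLp G 2 volume) :
    HasSum (fun m : Fin d → ℤ => conj (∫ x in E, mFourier (-m) (q x) * F x) *
      (∫ x in E, mFourier (-m) (q x) * G x)) ((c⁻¹ : ℝ) * ∫ x in E, conj (F x) * G x) := by
  have hemb : MeasurableEmbedding (E.domRestrict q) :=
    ContinuousOn.measurableEmbedding hE hq.continuousOn hinj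
  have himg : MeasurableSet (q '' E) := hE.image_of_continuousOn_injOn hq.continuousOn hinj
  have hmap : ENNReal.ofReal c • (volume.restrict E).map q = volume.restrict (q '' E) := by
    ext A hA
    have hA' : MeasurableSet (q ⁻¹' A) := hq.measurable hA
    rw [Measure.smul_apply, Measure.map_apply hq.measurable hA, Measure.restrict_apply hA',
      Measure.restrict_apply hA, smul_eq_mul, ← hvol _ Set.inter_subset_right (hA'.inter hE)]
    congr 1
    ext t
    constructor
    · rintro ⟨x, ⟨hx, hxE⟩, rfl⟩
      exact ⟨hx, x, hxE, rfl⟩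
    · rintro ⟨hx, x, hxE, rfl⟩
      exact ⟨x, ⟨hx, hxE⟩, rfl⟩
  let ext (F : (Fin d → ℝ) → ℂ) : UnitAddTorus (Fin d) → ℂ :=
    Function.extend (E.domRestrict q) (E.domRestrict F) 0
  have hext_meas : ∀ {F : (Fin d → ℝ) → ℂ}, Measurable F → Measurable (ext F) := fun hF =>
    hemb.measurable_extend (hF.comp measurable_subtype_coe) measurable_const
  have hext : ∀ (F : (Fin d → ℝ) → ℂ) {x}, x ∈ E → ext F (q x) = F x := fun F x hx =>
    hemb.injective.extend_apply (E.domRestrict F) 0 ⟨x, hx⟩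
  have hext0 : ∀ (F : (Fin d → ℝ) → ℂ) {t}, t ∉ q '' E → ext F t = 0 := fun F t ht =>
    Function.extend_apply' _ _ _ fun ⟨x, hx⟩ => ht ⟨x, x.2, hx⟩
  have hLp : ∀ {F : (Fin d → ℝ) → ℂ}, Measurable F → MemLp F 2 volume →
      MemLp (ext F) 2 volume := fun {F} hFm hF => by
    have h1 : (q '' E).indicator (ext F) = ext F := by
      funext t
      by_cases ht : t ∈ q '' E
      · simp [ht]
      · simp [ht, hext0 F ht]
    rw [← h1, memLp_indicator_iff_restrict himg, ← hmap]
    refine MemLp.smul_measure ?_ ENNReal.ofReal_ne_top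
    rw [memLp_map_measure_iff (hext_meas hFm).aestronglyMeasurable hq.measurable.aemeasurable]
    refine (memLp_congr_ae ?_).2 (hF.restrict E)
    filter_upwards [ae_restrict_mem hE] with x hx
    exact hext F hx
  have hint : ∀ Θ : UnitAddTorus (Fin d) → ℂ, Measurable Θ → (∀ t ∉ q '' E, Θ t = 0) →
      ∫ t, Θ t = c * ∫ x in E, Θ (q x) := fun Θ hΘ h0 => by
    rw [← setIntegral_eq_integral_of_forall_compl_eq_zero h0, ← hmap, integral_smul_measure,
      integral_map hq.measurable.aemeasurable hΘ.aestronglyMeasurable,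
      ENNReal.toReal_ofReal hc.le, Complex.real_smul]
  have hcoef : ∀ {F : (Fin d → ℝ) → ℂ}, Measurable F → ∀ m : Fin d → ℤ,
      mFourierCoeff (ext F) m = c * ∫ x in E, mFourier (-m) (q x) * F x := fun {F} hF m => by
    have hmeas : Measurable fun t => mFourier (-m) t • ext F t :=
      (mFourier (-m)).continuous.measurable.smul (hext_meas hF)
    rw [mFourierCoeff, hint _ hmeas fun t ht => by rw [hext0 F ht, smul_zero]]
    congr 1
    refine setIntegral_congr_fun hE fun x hx => ?_
    simp only [hext F hx, smul_eq_mul]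
  have hsum := hasSum_mFourierCoeff_of_memLp (hLp hFm hF) (hLp hGm hG)
  have hmeas : Measurable fun t => conj (ext F t) * ext G t :=
    (Complex.continuous_conj.measurable.comp (hext_meas hFm)).mul (hext_meas hGm)
  rw [hint _ hmeas fun t ht => by rw [hext0 G ht, mul_zero]] at hsum
  have hc' : (c : ℂ) ≠ 0 := by exact_mod_cast hc.ne'
  have hsum' := hsum.mul_left ((c : ℂ)⁻¹ ^ 2)
  have hval : (c : ℂ)⁻¹ ^ 2 * (c * ∫ x in E, conj (ext F (q x)) * ext G (q x)) =
      (c⁻¹ : ℝ) * ∫ x in E, conj (F x) * G x := by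
    rw [setIntegral_congr_fun (g := fun x => conj (F x) * G x) hE fun x hx => by
      simp only [hext F hx, hext G hx]]
    push_cast
    field_simp
  rw [hval] at hsum'
  refine HasSum.congr_fun hsum' fun m => ?_
  rw [hcoef hFm, hcoef hGm, map_mul, Complex.conj_ofReal]
  field_simp

/-- The map `x ↦ Bᵀ x mod ℤ^d`. -/
def latticeMk {d : ℕ} (B : Matrix (Fin d) (Fin d) ℝ) (x : Fin d → ℝ) : UnitAddTorus (Fin d) :=
  torusMk (B.transpose.mulVec x)

theorem continuous_latticeMk {d : ℕ} (B : Matrix (Fin d) (Fin d) ℝ) :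
    Continuous (latticeMk B) :=
  continuous_torusMk.comp (Continuous.matrix_mulVec continuous_const continuous_id)

/-- The open cube `y + (0,2)^d`. -/
def openCube {d : ℕ} (y : Fin d → ℝ) : Set (Fin d → ℝ) := {x | ∀ j, x j - y j ∈ Set.Ioo (0 : ℝ) 2}

theorem measurableSet_openCube {d : ℕ} (y : Fin d → ℝ) : MeasurableSet (openCube y) := by
  have h : openCube y = ⋂ j, {x | x j - y j ∈ Set.Ioo (0 : ℝ) 2} := by
    ext x; simp [openCube]
  rw [h]
  refine MeasurableSet.iInter fun j => ?_
  have hm : Measurable fun x : Fin d → ℝ => x j - y j := (measurable_pi_apply j).sub_const _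
  exact hm measurableSet_Ioo

theorem injOn_latticeMk {d : ℕ} {B : Matrix (Fin d) (Fin d) ℝ} (hB : IsUnit B.det)
    (hlat : LatticeCondition B 2) (y : Fin d → ℝ) : Set.InjOn (latticeMk B) (openCube y) := by
  intro x hx z hz h
  obtain ⟨n, hn⟩ := torusMk_eq_iff.1 h
  have hBt : IsUnit B.transpose.det := by rwa [Matrix.det_transpose]
  have hxz : x - z = (B.transpose)⁻¹.mulVec (intVec n) := by
    rw [← hn, ← Matrix.mulVec_sub, Matrix.mulVec_mulVec, Matrix.nonsing_inv_mul _ hBt,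
      Matrix.one_mulVec]
  by_cases hn0 : n = 0
  · have h0 : intVec n = 0 := by subst hn0; funext i; simp [intVec]
    rw [h0, Matrix.mulVec_zero] at hxz
    exact sub_eq_zero.1 hxz
  · refine absurd ?_ (hlat n hn0)
    rw [← hxz]
    intro j _
    have h1 := hx j
    have h2 := hz j
    simp only [Set.mem_Ioo] at h1 h2
    simp only [Pi.sub_apply, Set.mem_Ioo]
    push_cast
    constructor <;> linarith

theorem volume_image_latticeMk {d : ℕ} {B : Matrix (Fin d) (Fin d) ℝ} (hB : IsUnit B.det)
    {A : Set (Fin d → ℝ)} (hA : MeasurableSet A) (hinj : Set.InjOn (latticeMk B) A) :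
    volume (latticeMk B '' A) = ENNReal.ofReal |B.det| * volume A := by
  have hBt : IsUnit B.transpose.det := by rwa [Matrix.det_transpose]
  have h1 : latticeMk B '' A = torusMk '' ((Matrix.toLin' B.transpose) '' A) := by
    rw [← Set.image_comp]; rfl
  have hinj1 : Set.InjOn (Matrix.toLin' B.transpose) A := fun x hx y hy h =>
    hinj hx hy (by simp only [latticeMk, ← Matrix.toLin'_apply, h])
  have hinj2 : Set.InjOn torusMk ((Matrix.toLin' B.transpose) '' A) := by
    rintro _ ⟨x, hx, rfl⟩ _ ⟨y, hy, rfl⟩ h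
    rw [hinj hx hy h]
  rw [h1, volume_image_torusMk _ hinj2, Measure.addHaar_image_linearMap, LinearMap.det_toLin',
    Matrix.det_transpose]
  exact hA.image_of_continuousOn_injOn
    (LinearMap.continuous_of_finiteDimensional _).continuousOn hinj1

theorem mFourier_neg_latticeMk {d : ℕ} (B : Matrix (Fin d) (Fin d) ℝ) (m : Fin d → ℤ)
    (x : Fin d → ℝ) : mFourier (-m) (latticeMk B x) =
      conj (Complex.exp (2 * (Real.pi : ℂ) * Complex.I *
        ((B.mulVec (intVec m) ⬝ᵥ x : ℝ) : ℂ))) := by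
  rw [mFourier_neg]
  congr 1
  have h : B.mulVec (intVec m) ⬝ᵥ x = ∑ i, (m i : ℝ) * B.transpose.mulVec x i := by
    rw [dotProduct_comm, Matrix.dotProduct_mulVec, dotProduct_comm, Matrix.mulVec_transpose]
    rfl
  rw [h]
  simp only [mFourier, ContinuousMap.coe_mk, latticeMk, torusMk, fourier_coe_apply]
  rw [← Complex.exp_sum]
  congr 1
  push_cast
  rw [Finset.mul_sum]
  refine Finset.sum_congr rfl fun i _ => ?_
  ring

/-- Parseval's identity for `{E_{Bm}}` on a cube of side length `2`. -/
theorem hasSum_setIntegral_modulation {d : ℕ} {B : Matrix (Fin d) (Fin d) ℝ} (hB : IsUnit B.det)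
    (hlat : LatticeCondition B 2) (y : Fin d → ℝ) {F G : (Fin d → ℝ) → ℂ}
    (hFm : Measurable F) (hGm : Measurable G) (hF : MemLp F 2 volume) (hG : MemLp G 2 volume) :
    HasSum (fun m : Fin d → ℤ =>
      conj (∫ x in openCube y, conj (Complex.exp (2 * (Real.pi : ℂ) * Complex.I *
        ((B.mulVec (intVec m) ⬝ᵥ x : ℝ) : ℂ))) * F x) *
      (∫ x in openCube y, conj (Complex.exp (2 * (Real.pi : ℂ) * Complex.I *
        ((B.mulVec (intVec m) ⬝ᵥ x : ℝ) : ℂ))) * G x))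
      ((|B.det|⁻¹ : ℝ) * ∫ x in openCube y, conj (F x) * G x) := by
  have hinj := injOn_latticeMk hB hlat y
  have h := hasSum_setIntegral_mFourier (measurableSet_openCube y) (continuous_latticeMk B) hinj
    (abs_pos.2 hB.ne_zero)
    (fun A hAE hA => volume_image_latticeMk hB hA (hinj.mono hAE)) hFm hGm hF hG
  simpa only [mFourier_neg_latticeMk] using h

section Frames

variable {ι H : Type*} [NormedAddCommGroup H] [InnerProductSpace ℂ H]

/-- The Bessel inequality `∑ᵢ |⟨x, f i⟩|² ≤ C ‖x‖²`. -/
def IsBessel (f : ι → H) (C : ℝ) : Prop :=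
  ∀ x : H, Summable (fun i => ‖inner ℂ (f i) x‖ ^ 2) ∧ ∑' i, ‖inner ℂ (f i) x‖ ^ 2 ≤ C * ‖x‖ ^ 2

theorem IsBessel.norm_sum_smul_sq_le {f : ι → H} {C : ℝ} (hC : 0 ≤ C) (hf : IsBessel f C)
    (s : Finset ι) (c : ι → ℂ) : ‖∑ i ∈ s, c i • f i‖ ^ 2 ≤ C * ∑ i ∈ s, ‖c i‖ ^ 2 := by
  set S := ∑ i ∈ s, c i • f i with hS
  have h1 : ‖S‖ ^ 2 ≤ ∑ i ∈ s, ‖c i‖ * ‖inner ℂ (f i) S‖ := by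
    have h2 : (inner ℂ S S : ℂ) = ∑ i ∈ s, conj (c i) * inner ℂ (f i) S := by
      conv_lhs =>
        enter [2]
        rw [hS]
      rw [sum_inner]
      simp only [inner_smul_left]
    have h3 : ‖(inner ℂ S S : ℂ)‖ = ‖S‖ ^ 2 := by
      rw [inner_self_eq_norm_sq_to_K]; simp
    rw [← h3, h2]
    refine (norm_sum_le _ _).trans (le_of_eq (Finset.sum_congr rfl fun i _ => ?_))
    rw [norm_mul, RCLike.norm_conj]
  have h4 : ∑ i ∈ s, ‖inner ℂ (f i) S‖ ^ 2 ≤ C * ‖S‖ ^ 2 :=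
    ((hf S).1.sum_le_tsum s fun _ _ => by positivity).trans (hf S).2
  have h5 := Finset.sum_mul_sq_le_sq_mul_sq s (fun i => ‖c i‖) fun i => ‖inner ℂ (f i) S‖
  have h6 : 0 ≤ ∑ i ∈ s, ‖c i‖ ^ 2 := Finset.sum_nonneg fun _ _ => by positivity
  have h7 : (‖S‖ ^ 2) ^ 2 ≤ (C * ∑ i ∈ s, ‖c i‖ ^ 2) * ‖S‖ ^ 2 := calc
    (‖S‖ ^ 2) ^ 2 ≤ (∑ i ∈ s, ‖c i‖ * ‖inner ℂ (f i) S‖) ^ 2 := by gcongr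
    _ ≤ (∑ i ∈ s, ‖c i‖ ^ 2) * ∑ i ∈ s, ‖inner ℂ (f i) S‖ ^ 2 := h5
    _ ≤ (∑ i ∈ s, ‖c i‖ ^ 2) * (C * ‖S‖ ^ 2) := by gcongr
    _ = _ := by ring
  rcases (sq_nonneg ‖S‖).eq_or_lt with h0 | h0
  · rw [← h0]; positivity
  · rw [sq (‖S‖ ^ 2)] at h7
    exact le_of_mul_le_mul_right h7 h0

theorem IsBessel.summable_smul [CompleteSpace H] {f : ι → H} {C : ℝ} (hC : 0 ≤ C)
    (hf : IsBessel f C) {c : ι → ℂ} (hc : Summable fun i => ‖c i‖ ^ 2) :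
    Summable fun i => c i • f i := by
  rw [summable_iff_vanishing_norm]
  intro ε hε
  obtain ⟨s, hs⟩ := summable_iff_vanishing_norm.1 hc (ε ^ 2 / (C + 1)) (by positivity)
  refine ⟨s, fun t ht => ?_⟩
  have h1 := hf.norm_sum_smul_sq_le hC t c
  have h2 : ∑ i ∈ t, ‖c i‖ ^ 2 < ε ^ 2 / (C + 1) := (le_abs_self _).trans_lt (hs t ht)
  have h3 : 0 ≤ ∑ i ∈ t, ‖c i‖ ^ 2 := Finset.sum_nonneg fun _ _ => by positivity
  rw [lt_div_iff₀ (by positivity)] at h2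
  exact lt_of_pow_lt_pow_left₀ 2 hε.le (by nlinarith)

theorem IsBessel.hasSum_smul [CompleteSpace H] {f g : ι → H} {C D : ℝ} (hD : 0 ≤ D)
    (hf : IsBessel f C) (hg : IsBessel g D)
    (hfg : ∀ x y : H, HasSum (fun i => inner ℂ x (g i) * inner ℂ (f i) y) (inner ℂ x y)) (y : H) :
    HasSum (fun i => inner ℂ (f i) y • g i) y := by
  have hs := hg.summable_smul hD (hf y).1
  convert hs.hasSum using 1
  refine ext_inner_left ℂ fun x => ?_
  have h := hs.hasSum.mapL (innerSL ℂ x)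
  refine (hfg x y).unique (HasSum.congr_fun h fun i => ?_)
  rw [innerSL_apply_apply, inner_smul_right, mul_comm]

theorem isFrame_of_isBessel {f g : ι → H} {C D : ℝ} (hD : 0 ≤ D)
    (hf : IsBessel f C) (hg : IsBessel g D)
    (hfg : ∀ x y : H, HasSum (fun i => inner ℂ x (g i) * inner ℂ (f i) y) (inner ℂ x y)) :
    IsFrame f := by
  refine ⟨(D + 1)⁻¹, C, by positivity, fun x => ⟨(hf x).1, ?_, (hf x).2⟩⟩
  set S := ∑' i, ‖inner ℂ (f i) x‖ ^ 2 with hS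
  have hS0 : 0 ≤ S := tsum_nonneg fun _ => by positivity
  have h1 : (‖x‖ ^ 2) ^ 2 ≤ (D * ‖x‖ ^ 2) * S := by
    have h3 : ‖(inner ℂ x x : ℂ)‖ = ‖x‖ ^ 2 := by
      rw [inner_self_eq_norm_sq_to_K]; simp
    rw [← h3]
    have ht : Filter.Tendsto (fun s : Finset ι =>
        ‖∑ i ∈ s, inner ℂ x (g i) * inner ℂ (f i) x‖ ^ 2) Filter.atTop
        (nhds (‖(inner ℂ x x : ℂ)‖ ^ 2)) := ((hfg x x).norm).pow 2
    refine le_of_tendsto ht (Filter.Eventually.of_forall fun s => ?_)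
    calc ‖∑ i ∈ s, inner ℂ x (g i) * inner ℂ (f i) x‖ ^ 2
        ≤ (∑ i ∈ s, ‖inner ℂ (g i) x‖ * ‖inner ℂ (f i) x‖) ^ 2 := by
          gcongr
          refine (norm_sum_le _ _).trans (le_of_eq (Finset.sum_congr rfl fun i _ => ?_))
          rw [norm_mul, norm_inner_symm]
      _ ≤ (∑ i ∈ s, ‖inner ℂ (g i) x‖ ^ 2) * ∑ i ∈ s, ‖inner ℂ (f i) x‖ ^ 2 :=
          Finset.sum_mul_sq_le_sq_mul_sq s _ _
      _ ≤ (D * ‖x‖ ^ 2) * S := by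
          gcongr
          · exact ((hg x).1.sum_le_tsum s fun _ _ => by positivity).trans (hg x).2
          · exact (hf x).1.sum_le_tsum s fun _ _ => by positivity
      _ = _ := by rw [h3]
  rw [inv_mul_le_iff₀ (by positivity)]
  rcases (sq_nonneg ‖x‖).eq_or_lt with h0 | h0
  · rw [← h0]; positivity
  · have h2 : ‖x‖ ^ 2 ≤ D * S := by
      refine le_of_mul_le_mul_right ?_ h0
      nlinarith
    linarith

/-- Two Bessel sequences that are dual in the weak sense form a pair of dual frames. -/
theorem isDualFramePair_of_isBessel [CompleteSpace H] {f g : ι → H} {C D : ℝ} (hC : 0 ≤ C)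
    (hD : 0 ≤ D) (hf : IsBessel f C) (hg : IsBessel g D)
    (hfg : ∀ x y : H, HasSum (fun i => inner ℂ x (g i) * inner ℂ (f i) y) (inner ℂ x y)) :
    IsDualFramePair f g := by
  have hgf : ∀ x y : H, HasSum (fun i => inner ℂ x (f i) * inner ℂ (g i) y) (inner ℂ x y) := by
    intro x y
    rw [← inner_conj_symm]
    refine HasSum.congr_fun ((RCLike.hasSum_conj' ℂ).2 (hfg y x)) fun i => ?_
    rw [map_mul, inner_conj_symm, inner_conj_symm, mul_comm]
  exact ⟨isFrame_of_isBessel hD hf hg hfg, isFrame_of_isBessel hC hg hf hgf,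
    fun x => ⟨hf.hasSum_smul hD hg hfg x, hg.hasSum_smul hC hf hgf x⟩⟩

end Frames

/-- The arch `sin^L(π t / 2) χ_{[0,2]}(t)`. -/
def sinArch (L : ℕ) (t : ℝ) : ℝ :=
  (Set.Icc (0 : ℝ) 2).indicator (fun t => Real.sin (Real.pi * t / 2) ^ L) t

theorem sinArch_of_mem {L : ℕ} {t : ℝ} (ht : t ∈ Set.Icc (0 : ℝ) 2) :
    sinArch L t = Real.sin (Real.pi * t / 2) ^ L := Set.indicator_of_mem ht _

theorem sinArch_of_notMem_Ioo {L : ℕ} (hL : L ≠ 0) {t : ℝ} (ht : t ∉ Set.Ioo (0 : ℝ) 2) :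
    sinArch L t = 0 := by
  by_cases h : t ∈ Set.Icc (0 : ℝ) 2
  · rw [sinArch_of_mem h]
    have h1 : t = 0 ∨ t = 2 := by
      simp only [Set.mem_Ioo, Set.mem_Icc, not_and, not_lt] at h ht
      rcases h.1.eq_or_lt with h0 | h0
      · exact Or.inl h0.symm
      · exact Or.inr (le_antisymm h.2 (ht h0))
    rcases h1 with rfl | rfl <;> simp [hL]
  · exact Set.indicator_of_notMem h _

theorem continuous_sinArch {L : ℕ} (hL : L ≠ 0) : Continuous (sinArch L) := by
  have h : sinArch L = fun t => Real.sin (Real.pi * (max 0 (min t 2)) / 2) ^ L := by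
    funext t
    rcases le_total t 0 with h0 | h0
    · rw [sinArch_of_notMem_Ioo hL fun h => absurd h.1 (not_lt.2 h0), min_eq_left (by linarith),
        max_eq_left h0]
      simp [hL]
    rcases le_total t 2 with h2 | h2
    · rw [sinArch_of_mem ⟨h0, h2⟩, min_eq_left h2, max_eq_right h0]
    · rw [sinArch_of_notMem_Ioo hL fun h => absurd h.2 (not_lt.2 h2), min_eq_right h2]
      simp [hL]
  rw [h]
  fun_prop

theorem hasDerivAt_sinArch {L : ℕ} (hL : L ≠ 0) (t : ℝ) :
    HasDerivAt (sinArch (L + 1))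
      ((L + 1 : ℕ) * (Real.cos (Real.pi * t / 2) * (Real.pi / 2)) * sinArch L t) t := by
  have hsin (t : ℝ) : HasDerivAt (fun t => Real.sin (Real.pi * t / 2) ^ (L + 1))
      ((L + 1 : ℕ) * (Real.cos (Real.pi * t / 2) * (Real.pi / 2)) *
        Real.sin (Real.pi * t / 2) ^ L) t := by
    have h1 : HasDerivAt (fun t : ℝ => Real.pi * t / 2) (Real.pi / 2) t := by
      simpa using ((hasDerivAt_id t).const_mul Real.pi).div_const 2
    refine (h1.sin.pow (L + 1)).congr_deriv ?_
    rw [Nat.add_sub_cancel]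
    ring
  have hIcc : t ∈ Set.Icc (0 : ℝ) 2 → HasDerivWithinAt (sinArch (L + 1))
      ((L + 1 : ℕ) * (Real.cos (Real.pi * t / 2) * (Real.pi / 2)) * sinArch L t)
      (Set.Icc 0 2) t := fun ht => by
    rw [sinArch_of_mem ht]
    exact (hsin t).hasDerivWithinAt.congr (fun x hx => sinArch_of_mem hx) (sinArch_of_mem ht)
  have hout : t ∈ (Set.Ioo (0 : ℝ) 2)ᶜ → HasDerivWithinAt (sinArch (L + 1))
      ((L + 1 : ℕ) * (Real.cos (Real.pi * t / 2) * (Real.pi / 2)) * sinArch L t)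
      (Set.Ioo 0 2)ᶜ t := fun ht => by
    rw [sinArch_of_notMem_Ioo hL ht, mul_zero]
    exact (hasDerivWithinAt_const t _ (0 : ℝ)).congr
      (fun x hx => sinArch_of_notMem_Ioo L.succ_ne_zero hx)
      (sinArch_of_notMem_Ioo L.succ_ne_zero ht)
  by_cases h1 : t ∈ Set.Ioo (0 : ℝ) 2
  · exact (hIcc (Set.Ioo_subset_Icc_self h1)).hasDerivAt (Icc_mem_nhds h1.1 h1.2)
  by_cases h2 : t ∈ Set.Icc (0 : ℝ) 2
  · have h3 := (hIcc h2).union (hout h1)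
    rwa [Set.eq_univ_of_forall (s := Set.Icc (0 : ℝ) 2 ∪ (Set.Ioo 0 2)ᶜ) fun x => by
      by_cases hx : x ∈ Set.Ioo (0 : ℝ) 2
      · exact Or.inl (Set.Ioo_subset_Icc_self hx)
      · exact Or.inr hx, hasDerivWithinAt_univ] at h3
  · refine (hout h1).hasDerivAt (Filter.mem_of_superset (isClosed_Icc.isOpen_compl.mem_nhds h2) ?_)
    exact Set.compl_subset_compl.2 Set.Ioo_subset_Icc_self

theorem contDiff_sinArch (L : ℕ) : ContDiff ℝ (L : WithTop ℕ∞) (sinArch (L + 1)) := by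
  induction L with
  | zero => exact contDiff_zero.2 (continuous_sinArch one_ne_zero)
  | succ L ih =>
    have h := hasDerivAt_sinArch L.succ_ne_zero
    push_cast
    rw [contDiff_succ_iff_deriv]
    refine ⟨fun t => (h t).differentiableAt, fun hω => absurd hω (by simp), ?_⟩
    rw [funext fun t => (h t).deriv]
    refine ContDiff.mul ?_ ih
    fun_prop

/-- The trigonometric polynomial `∑_{k<L} binom(2L-1, k) sin^{2(L-1-k)} cos^{2k}`. -/
def dualFactor (L : ℕ) (t : ℝ) : ℝ :=
  ∑ k ∈ Finset.range L, ((2 * L - 1).choose k : ℝ) *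
    Real.sin (Real.pi * t / 2) ^ (2 * (L - 1 - k)) * Real.cos (Real.pi * t / 2) ^ (2 * k)

theorem contDiff_dualFactor (L : ℕ) {n : WithTop ℕ∞} : ContDiff ℝ n (dualFactor L) := by
  unfold dualFactor
  fun_prop

theorem sum_choose_half (L : ℕ) (hL : 1 ≤ L) (a b : ℝ) :
    a ^ L * ∑ k ∈ Finset.range L, ((2 * L - 1).choose k : ℝ) * a ^ (L - 1 - k) * b ^ k +
    b ^ L * ∑ k ∈ Finset.range L, ((2 * L - 1).choose k : ℝ) * b ^ (L - 1 - k) * a ^ k =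
      (a + b) ^ (2 * L - 1) := by
  have h2 : 2 * L - 1 + 1 = L + L := by omega
  rw [add_comm a b, add_pow, h2, Finset.sum_range_add, Finset.mul_sum, Finset.mul_sum]
  congr 1
  · refine Finset.sum_congr rfl fun k hk => ?_
    have hk := Finset.mem_range.1 hk
    have : 2 * L - 1 - k = L + (L - 1 - k) := by omega
    rw [this, pow_add]
    ring
  · rw [← Finset.sum_range_reflect]
    refine Finset.sum_congr rfl fun k hk => ?_
    have hk := Finset.mem_range.1 hk
    have h3 : L - 1 - (L - 1 - k) = k := by omega
    have h4 : 2 * L - 1 - (L + k) = L - 1 - k := by omega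
    have h5 : (2 * L - 1).choose (L + k) = (2 * L - 1).choose (L - 1 - k) :=
      Nat.choose_symm_of_eq_add (by omega)
    rw [h3, h4, h5, pow_add]
    ring

/-- The partition of unity that makes the windows dual. -/
theorem sinArch_mul_dualFactor_add {L : ℕ} (hL : 1 ≤ L) {t : ℝ} (ht : t ∈ Set.Ioc (0 : ℝ) 1) :
    sinArch L t * (sinArch L t * dualFactor L t) +
      sinArch L (t + 1) * (sinArch L (t + 1) * dualFactor L (t + 1)) = 1 := by
  have hs : Real.sin (Real.pi * (t + 1) / 2) = Real.cos (Real.pi * t / 2) := by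
    rw [show Real.pi * (t + 1) / 2 = Real.pi * t / 2 + Real.pi / 2 by ring,
      Real.sin_add_pi_div_two]
  have hc : Real.cos (Real.pi * (t + 1) / 2) = -Real.sin (Real.pi * t / 2) := by
    rw [show Real.pi * (t + 1) / 2 = Real.pi * t / 2 + Real.pi / 2 by ring,
      Real.cos_add_pi_div_two]
  rw [sinArch_of_mem ⟨ht.1.le, by linarith [ht.2]⟩,
    sinArch_of_mem ⟨by linarith [ht.1], by linarith [ht.2]⟩, dualFactor, dualFactor, hs, hc]
  have h := sum_choose_half L hL (Real.sin (Real.pi * t / 2) ^ 2) (Real.cos (Real.pi * t / 2) ^ 2)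
  rw [Real.sin_sq_add_cos_sq, one_pow] at h
  rw [← h]
  simp only [pow_mul, neg_sq]
  ring

theorem cubeChar_eq_prod {d : ℕ} (x : Fin d → ℝ) :
    cubeChar x = ∏ j, (Set.Icc (0 : ℝ) 2).indicator (1 : ℝ → ℝ) (x j) := by
  by_cases h : ∀ j, x j ∈ Set.Icc (0 : ℝ) 2
  · have h1 : x ∈ Set.univ.pi fun _ : Fin d => Set.Icc (0 : ℝ) 2 := fun j _ => h j
    rw [cubeChar, Set.indicator_of_mem h1, Finset.prod_eq_one fun j _ => ?_]
    · rfl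
    · rw [Set.indicator_of_mem (h j)]; rfl
  · obtain ⟨j, hj⟩ := not_forall.1 h
    rw [cubeChar, Set.indicator_of_notMem fun h1 => hj (Set.mem_univ_pi.1 h1 j),
      Finset.prod_eq_zero (Finset.mem_univ j) (Set.indicator_of_notMem hj _)]

/-- The real window `g`. -/
def realWindowG (d L : ℕ) (x : Fin d → ℝ) : ℝ := ∏ j, sinArch L (x j)

/-- The real window `h`. -/
def realWindowH {d : ℕ} (B : Matrix (Fin d) (Fin d) ℝ) (L : ℕ) (x : Fin d → ℝ) : ℝ :=
  |B.det| * ∏ j, sinArch L (x j) * dualFactor L (x j)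

theorem windowG_eq (d L : ℕ) : windowG d L = fun x => (realWindowG d L x : ℂ) := by
  funext x
  rw [windowG, cubeChar_eq_prod, ← Finset.prod_mul_distrib, realWindowG]
  congr 1
  refine Finset.prod_congr rfl fun j _ => ?_
  by_cases h : x j ∈ Set.Icc (0 : ℝ) 2 <;> simp [sinArch, h]

theorem windowH_eq {d : ℕ} (B : Matrix (Fin d) (Fin d) ℝ) (L : ℕ) :
    windowH B L = fun x => (realWindowH B L x : ℂ) := by
  funext x
  rw [windowH, cubeChar_eq_prod, mul_assoc, ← Finset.prod_mul_distrib, realWindowH]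
  congr 2
  refine Finset.prod_congr rfl fun j _ => ?_
  by_cases h : x j ∈ Set.Icc (0 : ℝ) 2 <;> simp [sinArch, h, dualFactor]

theorem contDiff_realWindowG (d L : ℕ) (hL : 1 ≤ L) :
    ContDiff ℝ ((L - 1 : ℕ) : WithTop ℕ∞) (realWindowG d L) := by
  obtain ⟨L, rfl⟩ := Nat.exists_eq_add_of_le' hL
  exact contDiff_prod fun j _ => (contDiff_sinArch L).comp (contDiff_apply ℝ ℝ j)

theorem contDiff_realWindowH {d : ℕ} (B : Matrix (Fin d) (Fin d) ℝ) (L : ℕ) (hL : 1 ≤ L) :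
    ContDiff ℝ ((L - 1 : ℕ) : WithTop ℕ∞) (realWindowH B L) := by
  obtain ⟨L, rfl⟩ := Nat.exists_eq_add_of_le' hL
  exact contDiff_const.mul (contDiff_prod fun j _ =>
    ((contDiff_sinArch L).comp (contDiff_apply ℝ ℝ j)).mul
      ((contDiff_dualFactor (L + 1)).comp (contDiff_apply ℝ ℝ j)))

/-- The sum of the integer translates of a tensor product of functions supported in `(0,2]`. -/
theorem hasSum_prod_translates {d : ℕ} {w : ℝ → ℝ} (hw : ∀ t ∉ Set.Ioc (0 : ℝ) 2, w t = 0)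
    (t : Fin d → ℝ) {c : ℝ} (hc : ∀ s ∈ Set.Ioc (0 : ℝ) 1, w s + w (s + 1) = c) :
    HasSum (fun n : Fin d → ℤ => ∏ j, w ((t - intVec n) j)) (c ^ d) := by
  have h1 : ∀ j, ∑ k ∈ ({⌈t j⌉ - 1, ⌈t j⌉ - 2} : Finset ℤ), w (t j - k) = c := fun j => by
    rw [Finset.sum_pair (by omega), ← hc (t j - (⌈t j⌉ - 1)) ?_]
    · push_cast
      congr 2
      ring
    · have h1 := Int.ceil_lt_add_one (t j)
      have h2 := Int.le_ceil (t j)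
      constructor <;> linarith
  have h2 : c ^ d = ∑ n ∈ Fintype.piFinset fun j => ({⌈t j⌉ - 1, ⌈t j⌉ - 2} : Finset ℤ),
      ∏ j, w ((t - intVec n) j) := by
    simp only [Pi.sub_apply, intVec]
    rw [← Finset.prod_univ_sum (fun j => ({⌈t j⌉ - 1, ⌈t j⌉ - 2} : Finset ℤ))
      fun j k => w (t j - k)]
    simp [h1]
  rw [h2]
  refine hasSum_sum_of_ne_finset_zero fun n hn => ?_
  rw [Fintype.mem_piFinset] at hn
  obtain ⟨j, hj⟩ := not_forall.1 hn
  refine Finset.prod_eq_zero (Finset.mem_univ j) (hw _ fun h => hj ?_)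
  simp only [Pi.sub_apply, intVec, Set.mem_Ioc] at h
  have h3 : ⌈t j⌉ - 1 ≥ n j := by
    have : n j < ⌈t j⌉ := Int.lt_ceil.2 (by linarith)
    omega
  have h4 : ⌈t j⌉ ≤ n j + 2 := Int.ceil_le.2 (by push_cast; linarith)
  simp only [Finset.mem_insert, Finset.mem_singleton]
  omega

/-- The indicator function of `(0,2]^d`, as a product. -/
def cubeIndicator {d : ℕ} (x : Fin d → ℝ) : ℝ :=
  ∏ j, (Set.Ioc (0 : ℝ) 2).indicator (fun _ => (1 : ℝ)) (x j)

theorem cubeIndicator_nonneg {d : ℕ} (x : Fin d → ℝ) : 0 ≤ cubeIndicator x :=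
  Finset.prod_nonneg fun _ _ => Set.indicator_nonneg (fun _ _ => zero_le_one) _

theorem measurable_cubeIndicator {d : ℕ} : Measurable (cubeIndicator (d := d)) :=
  Finset.measurable_prod _ fun j _ =>
    (measurable_const.indicator measurableSet_Ioc).comp (measurable_pi_apply j)

theorem cubeIndicator_of_forall_mem {d : ℕ} {x : Fin d → ℝ} (hx : ∀ j, x j ∈ Set.Ioc (0 : ℝ) 2) :
    cubeIndicator x = 1 :=
  Finset.prod_eq_one fun j _ => Set.indicator_of_mem (hx j) _

theorem hasSum_cubeIndicator {d : ℕ} (t : Fin d → ℝ) :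
    HasSum (fun n : Fin d → ℤ => cubeIndicator (t - intVec n)) (2 ^ d) := by
  refine hasSum_prod_translates (fun t ht => Set.indicator_of_notMem ht _) t fun s hs => ?_
  have h1 : s ∈ Set.Ioc (0 : ℝ) 2 := ⟨hs.1, by linarith [hs.2]⟩
  have h2 : s + 1 ∈ Set.Ioc (0 : ℝ) 2 := ⟨by linarith [hs.1], by linarith [hs.2]⟩
  rw [Set.indicator_of_mem h1, Set.indicator_of_mem h2]
  norm_num

theorem integrable_conj_mul {d : ℕ} (x y : Lp ℂ 2 (volume : Measure (Fin d → ℝ))) :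
    Integrable fun t => conj (x t) * y t := by
  refine (L2.integrable_inner x y).congr (Filter.Eventually.of_forall fun t => ?_)
  simp only [RCLike.inner_apply, mul_comm]

theorem integral_conj_mul {d : ℕ} (x y : Lp ℂ 2 (volume : Measure (Fin d → ℝ))) :
    ∫ t, conj (x t) * y t = inner ℂ x y := by
  rw [L2.inner_def]
  simp only [RCLike.inner_apply, mul_comm]

theorem hasSum_integral_translates {d : ℕ} {ρ : (Fin d → ℝ) → ℝ} (hρ : Measurable ρ) {K c : ℝ}
    (hK : ∀ t, |ρ t| ≤ K * cubeIndicator t)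
    (hc : ∀ t, HasSum (fun n : Fin d → ℤ => ρ (t - intVec n)) c)
    (x y : Lp ℂ 2 (volume : Measure (Fin d → ℝ))) :
    HasSum (fun n : Fin d → ℤ => ∫ t, (ρ (t - intVec n) : ℂ) * (conj (x t) * y t))
      (c * inner ℂ x y) := by
  have hint := integrable_conj_mul x y
  have hb (t : Fin d → ℝ) : HasSum (fun n : Fin d → ℤ =>
      K * cubeIndicator (t - intVec n) * ‖conj (x t) * y t‖)
      (K * 2 ^ d * ‖conj (x t) * y t‖) :=
    ((hasSum_cubeIndicator t).mul_left K).mul_right _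
  rw [← integral_conj_mul, ← integral_const_mul]
  refine hasSum_integral_of_dominated_convergence
    (fun n t => K * cubeIndicator (t - intVec n) * ‖conj (x t) * y t‖) (fun n => ?_) (fun n => ?_)
    ?_ ?_ ?_
  · refine AEStronglyMeasurable.mul ?_ hint.1
    exact (Complex.measurable_ofReal.comp
      (hρ.comp (measurable_sub_const _))).aestronglyMeasurable
  · refine Filter.Eventually.of_forall fun t => ?_
    rw [norm_mul, Complex.norm_real]
    exact mul_le_mul_of_nonneg_right (hK _) (norm_nonneg _)
  · exact Filter.Eventually.of_forall fun t => (hb t).summable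
  · simp only [(hb _).tsum_eq]
    exact hint.norm.const_mul _
  · refine Filter.Eventually.of_forall fun t => ?_
    have h1 : HasSum (fun n : Fin d → ℤ => (ρ (t - intVec n) : ℂ)) (c : ℂ) :=
      Complex.hasSum_ofReal.2 (hc t)
    exact h1.mul_right _

theorem hasCompactSupport_of_eq_zero {d : ℕ} {u : (Fin d → ℝ) → ℝ}
    (h0 : ∀ x, (∃ j, x j ∉ Set.Ioo (0 : ℝ) 2) → u x = 0) : HasCompactSupport u := by
  refine HasCompactSupport.intro (K := Set.univ.pi fun _ => Set.Icc (0 : ℝ) 2)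
    (isCompact_univ_pi fun _ => isCompact_Icc) fun x hx => h0 x ?_
  by_contra! h
  exact hx fun j _ => Set.Ioo_subset_Icc_self (h j)

section Window

variable {d : ℕ} {B : Matrix (Fin d) (Fin d) ℝ} {u v : (Fin d → ℝ) → ℝ} {M N : ℝ}

/-- A continuous window bounded by `M` and vanishing outside `(0,2)^d`. -/
structure IsCubeWindow (u : (Fin d → ℝ) → ℝ) (M : ℝ) : Prop where
  continuous : Continuous u
  le : ∀ x, |u x| ≤ M
  eq_zero : ∀ x, (∃ j, x j ∉ Set.Ioo (0 : ℝ) 2) → u x = 0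

theorem IsCubeWindow.nonneg (hu : IsCubeWindow u M) : 0 ≤ M := (abs_nonneg _).trans (hu.le 0)

theorem IsCubeWindow.abs_mul_le (hu : IsCubeWindow u M) (hv : IsCubeWindow v N)
    (t : Fin d → ℝ) : |u t * v t| ≤ M * N * cubeIndicator t := by
  by_cases h : ∃ j, t j ∉ Set.Ioo (0 : ℝ) 2
  · rw [hu.eq_zero t h, zero_mul, abs_zero]
    exact mul_nonneg (mul_nonneg hu.nonneg hv.nonneg) (cubeIndicator_nonneg t)
  · push Not at h
    rw [cubeIndicator_of_forall_mem fun j => Set.Ioo_subset_Ioc_self (h j), mul_one, abs_mul]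
    exact mul_le_mul (hu.le t) (hv.le t) (abs_nonneg _) hu.nonneg

theorem IsCubeWindow.eq_zero_of_notMem (hu : IsCubeWindow u M) {n : Fin d → ℤ} {x : Fin d → ℝ}
    (hx : x ∉ openCube (intVec n)) : u (x - intVec n) = 0 :=
  hu.eq_zero _ (not_forall.1 hx)


theorem IsCubeWindow.memLp (hu : IsCubeWindow u M) :
    MemLp (fun x => (u x : ℂ)) 2 volume :=
  (hu.continuous.memLp_of_hasCompactSupport (hasCompactSupport_of_eq_zero hu.eq_zero)).ofReal

theorem IsCubeWindow.measurable_mul (hu : IsCubeWindow u M)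
    (f : Lp ℂ 2 (volume : Measure (Fin d → ℝ))) (y : Fin d → ℝ) :
    Measurable fun x => (u (x - y) : ℂ) * f x :=
  (Complex.measurable_ofReal.comp (hu.continuous.measurable.comp (measurable_sub_const _))).mul
    (Lp.stronglyMeasurable f).measurable

theorem IsCubeWindow.memLp_mul (hu : IsCubeWindow u M)
    (f : Lp ℂ 2 (volume : Measure (Fin d → ℝ))) (y : Fin d → ℝ) :
    MemLp (fun x => (u (x - y) : ℂ) * f x) 2 volume := by
  refine (Lp.memLp f).of_le_mul (hu.measurable_mul f y).aestronglyMeasurable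
    (c := M) (Filter.Eventually.of_forall fun x => ?_)
  rw [norm_mul, Complex.norm_real]
  exact mul_le_mul_of_nonneg_right (hu.le _) (norm_nonneg _)

theorem IsCubeWindow.inner_gaborSystem (hu : IsCubeWindow u M)
    (hL : MemLp (fun x => (u x : ℂ)) 2 volume) (m n : Fin d → ℤ)
    (f : Lp ℂ 2 (volume : Measure (Fin d → ℝ))) :
    inner ℂ (gaborSystem B (fun x => (u x : ℂ)) hL (m, n)) f =
      ∫ x in openCube (intVec n), conj (Complex.exp (2 * (Real.pi : ℂ) * Complex.I *
        ((B.mulVec (intVec m) ⬝ᵥ x : ℝ) : ℂ))) * ((u (x - intVec n) : ℂ) * f x) := by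
  rw [setIntegral_eq_integral_of_forall_compl_eq_zero fun x hx => by
    rw [hu.eq_zero_of_notMem hx]; simp, L2.inner_def]
  refine integral_congr_ae ?_
  filter_upwards [(memLp_modulate (B.mulVec (intVec m))
    (memLp_translate (intVec n) hL)).coeFn_toLp] with x hx
  rw [gaborSystem, hx, RCLike.inner_apply, modulate, translate, map_mul, Complex.conj_ofReal]
  ring

theorem IsCubeWindow.hasSum_modulation (hB : IsUnit B.det) (hlat : LatticeCondition B 2)
    (hu : IsCubeWindow u M) (hv : IsCubeWindow v N)
    (hLu : MemLp (fun x => (u x : ℂ)) 2 volume) (hLv : MemLp (fun x => (v x : ℂ)) 2 volume)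
    (x y : Lp ℂ 2 (volume : Measure (Fin d → ℝ))) (n : Fin d → ℤ) :
    HasSum (fun m => inner ℂ x (gaborSystem B (fun x => (u x : ℂ)) hLu (m, n)) *
        inner ℂ (gaborSystem B (fun x => (v x : ℂ)) hLv (m, n)) y)
      ((|B.det|⁻¹ : ℝ) * ∫ t, ((u (t - intVec n) * v (t - intVec n) : ℝ) : ℂ) *
        (conj (x t) * y t)) := by
  have h := hasSum_setIntegral_modulation hB hlat (intVec n) (hu.measurable_mul x (intVec n))
    (hv.measurable_mul y (intVec n)) (hu.memLp_mul x (intVec n)) (hv.memLp_mul y (intVec n))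
  rw [setIntegral_eq_integral_of_forall_compl_eq_zero fun x hx => by
    rw [hu.eq_zero_of_notMem hx]; simp] at h
  have h1 : ∫ t, ((u (t - intVec n) * v (t - intVec n) : ℝ) : ℂ) * (conj (x t) * y t) =
      ∫ t, conj ((u (t - intVec n) : ℂ) * x t) * ((v (t - intVec n) : ℂ) * y t) := by
    congr 1
    funext t
    rw [map_mul, Complex.conj_ofReal]
    push_cast
    ring
  rw [h1]
  refine HasSum.congr_fun h fun m => ?_
  rw [← inner_conj_symm, hu.inner_gaborSystem, hv.inner_gaborSystem]

theorem IsCubeWindow.isBessel (hB : IsUnit B.det) (hlat : LatticeCondition B 2)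
    (hu : IsCubeWindow u M) (hL : MemLp (fun x => (u x : ℂ)) 2 volume) :
    IsBessel (gaborSystem B (fun x => (u x : ℂ)) hL) (|B.det|⁻¹ * (M ^ 2 * 2 ^ d)) := by
  intro x
  set φ := gaborSystem B (fun x => (u x : ℂ)) hL
  have hdet : 0 ≤ |B.det|⁻¹ := by positivity
  have hx : ∀ t, conj (x t) * x t = ((‖x t‖ ^ 2 : ℝ) : ℂ) := fun t => by
    rw [mul_comm, Complex.mul_conj, Complex.normSq_eq_norm_sq]
  have hint : Integrable fun t => ‖x t‖ ^ 2 := (Lp.memLp x).integrable_norm_pow two_ne_zero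
  have hfib (n : Fin d → ℤ) : HasSum (fun m => ‖inner ℂ (φ (m, n)) x‖ ^ 2)
      (|B.det|⁻¹ * ∫ t, (u (t - intVec n) * u (t - intVec n)) * ‖x t‖ ^ 2) := by
    have h := hu.hasSum_modulation hB hlat hu hL hL x x n
    simp only [hx, ← Complex.ofReal_mul] at h
    rw [integral_complex_ofReal, ← Complex.ofReal_mul] at h
    rw [← Complex.hasSum_ofReal]
    refine HasSum.congr_fun h fun m => ?_
    rw [← inner_conj_symm x, mul_comm, Complex.mul_conj, Complex.normSq_eq_norm_sq]
  have hcube : HasSum (fun n : Fin d → ℤ => ∫ t, cubeIndicator (t - intVec n) * ‖x t‖ ^ 2)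
      (2 ^ d * ‖x‖ ^ 2) := by
    have h := hasSum_integral_translates measurable_cubeIndicator (K := 1)
      (fun t => by rw [one_mul, abs_of_nonneg (cubeIndicator_nonneg t)]) hasSum_cubeIndicator x x
    simp only [hx, ← Complex.ofReal_mul, integral_complex_ofReal] at h
    rw [← Complex.hasSum_ofReal]
    convert h using 1
    rw [inner_self_eq_norm_sq_to_K]
    push_cast
    rfl
  have hle (n : Fin d → ℤ) :
      |B.det|⁻¹ * ∫ t, (u (t - intVec n) * u (t - intVec n)) * ‖x t‖ ^ 2 ≤
      |B.det|⁻¹ * (M ^ 2 * ∫ t, cubeIndicator (t - intVec n) * ‖x t‖ ^ 2) := by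
    have hbd (t : Fin d → ℝ) := hu.abs_mul_le hu (t - intVec n)
    refine mul_le_mul_of_nonneg_left ?_ hdet
    rw [← integral_const_mul]
    refine integral_mono_of_nonneg (Filter.Eventually.of_forall fun t =>
      mul_nonneg (mul_self_nonneg _) (sq_nonneg _)) ?_ (Filter.Eventually.of_forall fun t => ?_)
    · refine (hint.bdd_mul (c := 1) ((measurable_cubeIndicator.comp
        (measurable_sub_const _)).aestronglyMeasurable)
        (Filter.Eventually.of_forall fun t => ?_)).const_mul _
      rw [Function.comp_apply, Real.norm_eq_abs, abs_of_nonneg (cubeIndicator_nonneg _)]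
      exact Finset.prod_le_one (fun _ _ => Set.indicator_nonneg (fun _ _ => zero_le_one) _)
        fun _ _ => Set.indicator_le_self' (fun _ _ => zero_le_one) _
    · have h := (le_abs_self _).trans (hbd t)
      calc _ ≤ (M * M * cubeIndicator (t - intVec n)) * ‖x t‖ ^ 2 :=
            mul_le_mul_of_nonneg_right h (sq_nonneg _)
        _ = _ := by ring
  have hmaj := (hcube.mul_left (M ^ 2)).mul_left |B.det|⁻¹
  have hsum : Summable fun p : (Fin d → ℤ) × (Fin d → ℤ) => ‖inner ℂ (φ (p.2, p.1)) x‖ ^ 2 := by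
    refine (summable_prod_of_nonneg fun _ => by positivity).2
      ⟨fun n => (hfib n).summable, ?_⟩
    refine Summable.of_nonneg_of_le (fun n => tsum_nonneg fun _ => by positivity)
      (fun n => ?_) hmaj.summable
    rw [(hfib n).tsum_eq]
    exact hle n
  have hswap : Summable fun p => ‖inner ℂ (φ p) x‖ ^ 2 :=
    (Equiv.prodComm (Fin d → ℤ) (Fin d → ℤ)).summable_iff.1 hsum
  refine ⟨hswap, ?_⟩
  have h1 : ∑' p, ‖inner ℂ (φ p) x‖ ^ 2 =
      ∑' p : (Fin d → ℤ) × (Fin d → ℤ), ‖inner ℂ (φ (p.2, p.1)) x‖ ^ 2 :=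
    ((Equiv.prodComm (Fin d → ℤ) (Fin d → ℤ)).tsum_eq fun p => ‖inner ℂ (φ p) x‖ ^ 2).symm
  have h2 := hsum.hasSum.prod_fiberwise hfib
  rw [h1]
  calc _ ≤ _ := hasSum_le hle h2 hmaj
    _ = _ := by ring

/-- Windows whose translated products sum to `|det B|` generate dual Gabor frames. -/
theorem IsCubeWindow.isDualFramePair (hB : IsUnit B.det) (hlat : LatticeCondition B 2)
    (hu : IsCubeWindow u M) (hv : IsCubeWindow v N)
    (hLu : MemLp (fun x => (u x : ℂ)) 2 volume) (hLv : MemLp (fun x => (v x : ℂ)) 2 volume)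
    (huv : ∀ t, HasSum (fun n : Fin d → ℤ => v (t - intVec n) * u (t - intVec n)) |B.det|) :
    IsDualFramePair (gaborSystem B (fun x => (u x : ℂ)) hLu)
      (gaborSystem B (fun x => (v x : ℂ)) hLv) := by
  have hbu := hu.isBessel hB hlat hLu
  have hbv := hv.isBessel hB hlat hLv
  refine isDualFramePair_of_isBessel (by positivity) (by positivity) hbu hbv fun x y => ?_
  have hsum : Summable fun p => inner ℂ x (gaborSystem B (fun x => (v x : ℂ)) hLv p) *
      inner ℂ (gaborSystem B (fun x => (u x : ℂ)) hLu p) y := by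
    refine Summable.of_norm_bounded ((hbv x).1.add (hbu y).1) fun p => ?_
    rw [norm_mul, norm_inner_symm]
    nlinarith [sq_nonneg (‖(inner ℂ (gaborSystem B (fun x => (v x : ℂ)) hLv p) x : ℂ)‖ -
      ‖(inner ℂ (gaborSystem B (fun x => (u x : ℂ)) hLu p) y : ℂ)‖),
      sq_nonneg ‖(inner ℂ (gaborSystem B (fun x => (v x : ℂ)) hLv p) x : ℂ)‖,
      sq_nonneg ‖(inner ℂ (gaborSystem B (fun x => (u x : ℂ)) hLu p) y : ℂ)‖]
  have h1 := ((Equiv.prodComm (Fin d → ℤ) (Fin d → ℤ)).hasSum_iff.2 hsum.hasSum).prod_fiberwise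
    (hv.hasSum_modulation hB hlat hu hLv hLu x y)
  have h2 := (hasSum_integral_translates (hv.continuous.mul hu.continuous).measurable
    (hv.abs_mul_le hu) huv x y).mul_left ((|B.det|⁻¹ : ℝ) : ℂ)
  have h3 := h1.unique h2
  have h4 : ((|B.det|⁻¹ : ℝ) : ℂ) * ((|B.det| : ℝ) * inner ℂ x y) = inner ℂ x y := by
    rw [← mul_assoc, ← Complex.ofReal_mul, inv_mul_cancel₀ (abs_ne_zero.2 hB.ne_zero)]
    simp
  rw [h4] at h3
  rw [← h3]
  exact hsum.hasSum

end Window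

theorem exists_isCubeWindow {d : ℕ} {u : (Fin d → ℝ) → ℝ} (hc : Continuous u)
    (h0 : ∀ x, (∃ j, x j ∉ Set.Ioo (0 : ℝ) 2) → u x = 0) : ∃ M, IsCubeWindow u M := by
  obtain ⟨M, hM⟩ := (hasCompactSupport_of_eq_zero h0).exists_bound_of_continuous hc
  exact ⟨M, hc, hM, h0⟩

theorem realWindowG_eq_zero {d L : ℕ} (hL : L ≠ 0) {x : Fin d → ℝ}
    (hx : ∃ j, x j ∉ Set.Ioo (0 : ℝ) 2) : realWindowG d L x = 0 := by
  obtain ⟨j, hj⟩ := hx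
  exact Finset.prod_eq_zero (Finset.mem_univ j) (sinArch_of_notMem_Ioo hL hj)

theorem realWindowH_eq_zero {d L : ℕ} (B : Matrix (Fin d) (Fin d) ℝ) (hL : L ≠ 0)
    {x : Fin d → ℝ} (hx : ∃ j, x j ∉ Set.Ioo (0 : ℝ) 2) : realWindowH B L x = 0 := by
  obtain ⟨j, hj⟩ := hx
  rw [realWindowH, Finset.prod_eq_zero (Finset.mem_univ j), mul_zero]
  rw [sinArch_of_notMem_Ioo hL hj, zero_mul]

theorem hasSum_realWindowH_mul_realWindowG {d L : ℕ} (hL : 1 ≤ L)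
    (B : Matrix (Fin d) (Fin d) ℝ) (t : Fin d → ℝ) :
    HasSum (fun n : Fin d → ℤ => realWindowH B L (t - intVec n) * realWindowG d L (t - intVec n))
      |B.det| := by
  have h := (hasSum_prod_translates (w := fun s => sinArch L s * (sinArch L s * dualFactor L s))
    (fun s hs => by
      rw [sinArch_of_notMem_Ioo (by omega) fun h => hs (Set.Ioo_subset_Ioc_self h), zero_mul])
    t fun s hs => sinArch_mul_dualFactor_add hL hs).mul_left |B.det|
  rw [one_pow, mul_one] at h
  refine HasSum.congr_fun h fun n => ?_
  rw [Finset.prod_mul_distrib, realWindowH, realWindowG]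
  ring

end GaborDual
end

theorem corollary4p3 (d L : ℕ) (hL : 1 ≤ L) (B : Matrix (Fin d) (Fin d) ℝ)
    (hB : IsUnit B.det) (hlat : GaborDual.LatticeCondition B 2) :
    ContDiff ℝ ((L - 1 : ℕ) : WithTop ℕ∞) (GaborDual.windowG d L) ∧
    ContDiff ℝ ((L - 1 : ℕ) : WithTop ℕ∞) (GaborDual.windowH B L) ∧
    ∃ (hg : MemLp (GaborDual.windowG d L) 2 volume)
      (hh : MemLp (GaborDual.windowH B L) 2 volume),
      GaborDual.IsDualFramePair
        (GaborDual.gaborSystem B (GaborDual.windowG d L) hg)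
        (GaborDual.gaborSystem B (GaborDual.windowH B L) hh) := by
  have hG := GaborDual.contDiff_realWindowG d L hL
  have hH := GaborDual.contDiff_realWindowH B L hL
  obtain ⟨M, hg⟩ := GaborDual.exists_isCubeWindow hG.continuous
    fun _ => GaborDual.realWindowG_eq_zero (by omega)
  obtain ⟨N, hh⟩ := GaborDual.exists_isCubeWindow hH.continuous
    fun _ => GaborDual.realWindowH_eq_zero B (by omega)
  rw [GaborDual.windowG_eq d L, GaborDual.windowH_eq B L]
  exact ⟨Complex.ofRealCLM.contDiff.comp hG, Complex.ofRealCLM.contDiff.comp hH, hg.memLp,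
    hh.memLp, hg.isDualFramePair hB hlat hh _ _
      (GaborDual.hasSum_realWindowH_mul_realWindowG hL B)⟩
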